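/- Let $S_\infty$ be the group of finitely supported permutations of $\{1,2,3,\dots\}$ and let $\gamma_n=(1,n+1)$, $n\ge 1$, be its star-transpositions. Let $d\ge 2$ and let $w_1\ge w_2\ge\cdots\ge w_d>0$ with $w_1+\cdots+w_d=1$; put $p_n=\sum_{i=1}^d w_i^n$ and $$\chi(\sigma)=\prod_{V\text{ orbit of }\sigma,\ |V|\ge 2}p_{|V|},\qquad \sigma\in S_\infty ,$$ which is a function of positive type on $S_\infty$. Let $U:S_\infty\to B(\mathcal H)$ be the GNS representation of $\chi$: $\mathcal H$ is a complex Hilbert space with vectors $\widehat\sigma$ ($\sigma\in S_\infty$) of dense linear span such that $\langle\widehat\sigma,\widehat\tau\rangle=\chi(\sigma\tau^{-1})$, and $U(\sigma)\widehat\tau=\widehat{\sigma\tau}$. Let $e$ be the unit of $S_\infty$ and put $\mathrm{tr}(T)=\langle T\widehat e,\widehat e\rangle$. Then the averages $\frac1n\sum_{i=1}^n U(\gamma_i)$ converge in the strong operator topology to an operator $A_0\in B(\mathcal H)$, the operators $$s_n=\frac1{\sqrt n}\sum_{i=1}^n\bigl(U(\gamma_i)-A_0\bigr),\qquad n\ge1,$$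 are self-adjoint, and if $\mu_n$ denotes the law of $s_n$ with respect to $\mathrm{tr}$, that is, the compactly supported probability measure on $\mathbb R$ with $\int t^k\,d\mu_n(t)=\mathrm{tr}(s_n^k)$ for all $k\ge0$, then the measures $\mu_n$ converge weak$^*$ (against bounded continuous functions), as $n\to\infty$, to a probability measure $\mu_{\underline w}$ on $\mathbb R$, which depends on $\underline w=(w_1,\dots,w_d)$. -/

import Mathlib

open Finset Filter MeasureTheory
open scoped Topology
open scoped ComplexConjugate InnerProductSpace

/-- The infinite symmetric group: the bijections of `ℕ` that move only finitely many points. -/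
def SInf : Subgroup (Equiv.Perm ℕ) where
  carrier := {σ | ∃ N, ∀ n, N ≤ n → σ n = n}
  one_mem' := ⟨0, fun _ _ => rfl⟩
  mul_mem' := by
    rintro σ τ ⟨N, hN⟩ ⟨M, hM⟩
    refine ⟨max N M, fun n hn => ?_⟩
    rw [Equiv.Perm.mul_apply, hM n (le_trans (le_max_right _ _) hn),
      hN n (le_trans (le_max_left _ _) hn)]
  inv_mem' := by
    rintro σ ⟨N, hN⟩
    refine ⟨N, fun n hn => ?_⟩
    rw [Equiv.Perm.inv_eq_iff_eq, hN n hn]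

/-- The star-transpositions. The points are numbered `0, 1, 2, …` instead of `1, 2, 3, …`, so
`starGen 0, starGen 1, …` are `(1,2), (1,3), …` in the usual one-based notation. -/
def starGen (i : ℕ) : SInf :=
  ⟨Equiv.swap 0 (i + 1), i + 2, fun n hn =>
    Equiv.swap_apply_of_ne_of_ne (by omega) (by omega)⟩

/-- The set of orbits of a permutation of `ℕ`, fixed points included. -/
def permOrbits (σ : Equiv.Perm ℕ) : Set (Set ℕ) := Set.range fun a => {b | σ.SameCycle a b}

/-- A tuple of weights `w₁ ≥ ⋯ ≥ w_d > 0` of sum `1`. -/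
structure Weights (d : ℕ) where
  w : Fin d → ℝ
  antitone : Antitone w
  pos : ∀ i, 0 < w i
  sum_eq_one : ∑ i, w i = 1

namespace Weights
variable {d : ℕ} (W : Weights d)

/-- The power sum `p_n = ∑ i, w_i ^ n`. -/
def powerSum (n : ℕ) : ℝ := ∑ i, W.w i ^ n

/-- The Thoma character: the product of `p_{|V|}` over the orbits `V` of `σ` with `|V| ≥ 2`.
There are finitely many such orbits, each of them finite. -/
noncomputable def chi (σ : SInf) : ℝ :=
  ∏ᶠ (V : Set ℕ) (_ : V ∈ permOrbits σ ∧ 2 ≤ V.ncard), W.powerSum V.ncard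

/-- A colouring of the first `N` points, extended by `none`. -/
def extendColouring {d N : ℕ} (f : Fin N → Fin d) (n : ℕ) : Option (Fin d) :=
  if h : n < N then some (f ⟨n, h⟩) else none

theorem extendColouring_comp_iff {N : ℕ} {σ : Equiv.Perm ℕ} (hσ : ∀ n, N ≤ n → σ n = n)
    (f : Fin N → Fin d) : extendColouring f ∘ σ = extendColouring f ↔
      ∀ a b : Fin N, σ.SameCycle a b → f a = f b := by
  have hlt : ∀ n, n < N → σ n < N := by
    intro n hn
    by_contra! h
    have := σ.injective (hσ _ h)
    omega
  constructor
  · intro h a b ⟨k, hk⟩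
    have h1 : ∀ n, extendColouring f (σ n) = extendColouring f n := fun n => congrFun h n
    have h2 : ∀ (k : ℤ) n, extendColouring f ((σ ^ k) n) = extendColouring f n := by
      intro k
      induction k using Int.induction_on with
      | zero => intro n; simp
      | succ k ih => intro n; rw [zpow_add_one, Equiv.Perm.mul_apply, ih, h1]
      | pred k ih =>
        intro n
        rw [zpow_sub_one, Equiv.Perm.mul_apply, ih]
        conv_rhs => rw [← Equiv.apply_symm_apply σ n]
        rw [h1]; rfl
    have h3 := h2 k a
    rw [hk] at h3
    simpa [extendColouring] using h3.symm
  · intro h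
    funext n
    by_cases hn : n < N
    · have h4 := hlt n hn
      have : f ⟨σ n, h4⟩ = f ⟨n, hn⟩ :=
        (h ⟨n, hn⟩ ⟨σ n, h4⟩ ⟨1, by simp⟩).symm
      simp [extendColouring, hn, h4, this]
    · simp [hσ n (not_lt.mp hn)]

open Classical in
/-- `χ(σ)` is the total weight of the `σ`-invariant colourings of the first `N` points. -/
theorem chi_eq_sum {N : ℕ} (σ : SInf) (hσ : ∀ n, N ≤ n → (σ : Equiv.Perm ℕ) n = n) :
    W.chi σ = ∑ f : Fin N → Fin d, (∏ i, W.w (f i)) *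
      (if extendColouring f ∘ (σ : Equiv.Perm ℕ) = extendColouring f then 1 else 0) := by
  obtain ⟨σ, hσ'⟩ := σ
  simp only at hσ
  let r : Setoid (Fin N) :=
    ⟨fun a b => σ.SameCycle a b, fun _ => Equiv.Perm.SameCycle.refl _ _,
      fun h => h.symm, fun h h' => h.trans h'⟩
  let Q := Quotient r
  let F : Q → Set ℕ := Quotient.lift (fun a : Fin N => {b | σ.SameCycle a b}) (by
    intro a b hab
    ext c
    exact ⟨fun h => Equiv.Perm.SameCycle.trans (Equiv.Perm.SameCycle.symm hab) h,
      fun h => Equiv.Perm.SameCycle.trans hab h⟩)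
  have hF : ∀ a, F (Quotient.mk r a) = {b | σ.SameCycle a b} := fun a => rfl
  have hfix : ∀ n, N ≤ n → ∀ m, σ.SameCycle n m → m = n := by
    intro n hn m hm
    have : Function.IsFixedPt σ n := hσ n hn
    exact (hm.eq_of_left this).symm
  have hFinj : Function.Injective F := by
    intro p q
    induction p using Quotient.inductionOn with | _ a
    induction q using Quotient.inductionOn with | _ b
    intro h
    rw [hF, hF] at h
    apply Quotient.sound
    have : (b : ℕ) ∈ {c | σ.SameCycle a c} := by
      rw [h]; exact Equiv.Perm.SameCycle.refl _ _
    exact this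
  have hcard : ∀ q, (F q).ncard = #{a : Fin N | Quotient.mk r a = q} := by
    intro q
    induction q using Quotient.inductionOn with | _ a
    rw [← Finset.card_map Fin.valEmbedding, ← Set.ncard_coe_finset]
    congr 1
    ext b
    simp only [hF, Set.mem_ofPred_eq, Finset.coe_map, Set.mem_image, Finset.mem_coe,
      Finset.mem_filter, Finset.mem_univ, true_and, Fin.valEmbedding_apply]
    constructor
    · intro h
      have hb : b < N := by
        by_contra! hb
        have := hfix b hb _ h.symm
        omega
      exact ⟨⟨b, hb⟩, Quotient.sound (Equiv.Perm.SameCycle.symm h), rfl⟩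
    · rintro ⟨c, hc, rfl⟩
      exact Equiv.Perm.SameCycle.symm (Quotient.exact hc)
  have hpos : ∀ q, 1 ≤ (F q).ncard := by
    intro q
    rw [hcard]
    induction q using Quotient.inductionOn with | _ a
    exact Finset.card_pos.mpr ⟨a, by simp⟩
  have h1 : W.chi ⟨σ, hσ'⟩ = ∏ q : Q, W.powerSum (F q).ncard := by
    have hset : {V : Set ℕ | V ∈ permOrbits σ ∧ 2 ≤ V.ncard} =
        F '' ↑({q : Q | 2 ≤ (F q).ncard} : Finset Q) := by
      ext V
      simp only [permOrbits, Set.mem_ofPred_eq, Set.mem_range, Set.mem_image, Finset.mem_coe,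
        Finset.mem_filter, Finset.mem_univ, true_and]
      constructor
      · rintro ⟨⟨a, rfl⟩, h⟩
        have ha : a < N := by
          by_contra! ha
          have : {b | σ.SameCycle a b} = {a} := by
            ext b
            exact ⟨hfix a ha b, by rintro rfl; exact Equiv.Perm.SameCycle.refl _ _⟩
          rw [this] at h
          simp at h
        exact ⟨Quotient.mk r ⟨a, ha⟩, h, rfl⟩
      · rintro ⟨q, hq, rfl⟩
        refine ⟨?_, hq⟩
        induction q using Quotient.inductionOn with | _ a
        exact ⟨a, rfl⟩
    have : W.chi ⟨σ, hσ'⟩ = ∏ᶠ V ∈ {V : Set ℕ | V ∈ permOrbits σ ∧ 2 ≤ V.ncard},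
      W.powerSum V.ncard := rfl
    rw [this, hset, finprod_mem_image hFinj.injOn, finprod_mem_coe_finset]
    apply Finset.prod_subset (Finset.subset_univ _)
    intro q _ hq
    have : (F q).ncard = 1 := by
      have := hpos q
      simp at hq
      omega
    simp [this, powerSum, W.sum_eq_one]
  rw [h1]
  simp only [powerSum]
  rw [Finset.prod_univ_sum, Fintype.piFinset_univ]
  simp only [mul_ite, mul_one, mul_zero]
  rw [← Finset.sum_filter]
  refine Finset.sum_bij' (fun g _ a => g (Quotient.mk r a))
    (fun f hf => Quotient.lift f ?_) ?_ ?_ ?_ ?_ ?_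
  · intro a b hab
    have := (extendColouring_comp_iff hσ f).1 (Finset.mem_filter.1 hf).2
    exact this a b hab
  · intro g _
    simp only [Finset.mem_filter, Finset.mem_univ, true_and]
    rw [extendColouring_comp_iff hσ]
    intro a b hab
    exact congrArg g (Quotient.sound hab)
  · intros; simp
  · intro g _
    funext q
    induction q using Quotient.inductionOn with | _ a
    rfl
  · intros; rfl
  · intro g _
    rw [← Finset.prod_fiberwise (s := univ) (g := fun a => Quotient.mk r a)]
    refine Finset.prod_congr rfl fun q _ => ?_
    rw [hcard]
    rw [Finset.prod_congr rfl (g := fun _ => W.w (g q))]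
    · rw [Finset.prod_const]
    · intro a ha
      exact congrArg (fun q => W.w (g q)) (Finset.mem_filter.1 ha).2

end Weights

theorem sum_indicator_nonneg {ι X : Type*} [DecidableEq X] (s : Finset ι) (c : ι → ℂ) (F : ι → X) :
    0 ≤ (∑ g ∈ s, ∑ h ∈ s, conj (c g) * c h * (if F g = F h then 1 else 0)).re := by
  have : ∑ g ∈ s, ∑ h ∈ s, conj (c g) * c h * (if F g = F h then 1 else 0) =
      ∑ x ∈ s.image F, conj (∑ g ∈ s with F g = x, c g) * ∑ g ∈ s with F g = x, c g := by
    rw [← Finset.sum_fiberwise_of_maps_to (g := F) (t := s.image F)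
      (fun g hg => Finset.mem_image_of_mem F hg)]
    refine Finset.sum_congr rfl fun x _ => ?_
    rw [map_sum, Finset.sum_mul]
    refine Finset.sum_congr rfl fun g hg => ?_
    rw [Finset.mul_sum, Finset.sum_filter]
    refine Finset.sum_congr rfl fun h _ => ?_
    rw [(Finset.mem_filter.1 hg).2]
    simp [eq_comm]
  rw [this, Complex.re_sum]
  refine Finset.sum_nonneg fun x _ => ?_
  rw [← Complex.normSq_eq_conj_mul_self, Complex.ofReal_re]
  exact Complex.normSq_nonneg _

/-- A function of positive type on a group: `φ(g⁻¹)` is the conjugate of `φ(g)`, and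
`∑ conj(c_g) c_h φ(g⁻¹ h) ≥ 0` for every finitely supported family `c` of complex numbers. -/
structure PosTypeFun (G : Type*) [Group G] where
  toFun : G → ℂ
  conj_inv : ∀ g, conj (toFun g⁻¹) = toFun g
  nonneg : ∀ c : G →₀ ℂ,
    0 ≤ (∑ g ∈ c.support, ∑ h ∈ c.support, conj (c g) * c h * toFun (g⁻¹ * h)).re

namespace Weights
variable {d : ℕ} (W : Weights d)

theorem extend_inv {N : ℕ} (g h : Equiv.Perm ℕ) (f : Fin N → Fin d) :
   extendColouring f ∘ (g⁻¹ * h : Equiv.Perm ℕ) = extendColouring f ↔ 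
     extendColouring f ∘ (g⁻¹ : Equiv.Perm ℕ) = extendColouring f ∘ (h⁻¹ : Equiv.Perm ℕ) := by
  constructor
  · intro H
    conv_rhs => rw [← H]
    funext n
    simp
  · intro H
    rw [Equiv.Perm.coe_mul, ← Function.comp_assoc, H]
    funext n
    simp

theorem chi_inv (σ : SInf) : W.chi σ⁻¹ = W.chi σ := by
  unfold chi permOrbits
  simp [Equiv.Perm.sameCycle_inv]

/-- The Thoma character as a function of positive type. -/
noncomputable def character : PosTypeFun SInf where
  toFun σ := (W.chi σ : ℂ)
  conj_inv σ := by rw [chi_inv, Complex.conj_ofReal]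
  nonneg c := by
    classical
    obtain ⟨N, hN⟩ : ∃ N, ∀ σ ∈ c.support, ∀ n, N ≤ n → (σ : Equiv.Perm ℕ) n = n := by
      have : ∀ σ : SInf, ∃ N, ∀ n, N ≤ n → (σ : Equiv.Perm ℕ) n = n := fun σ => σ.2
      choose M hM using this
      exact ⟨c.support.sup M, fun σ hσ n hn => hM σ n (le_trans (Finset.le_sup hσ) hn)⟩
    have key : ∀ g ∈ c.support, ∀ h ∈ c.support, conj (c g) * c h * (W.chi (g⁻¹ * h) : ℂ) =
        ∑ f : Fin N → Fin d, ((∏ i, W.w (f i) : ℝ) : ℂ) * (conj (c g) * c h *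
          (if extendColouring f ∘ ((g : Equiv.Perm ℕ)⁻¹ : Equiv.Perm ℕ) =
            extendColouring f ∘ ((h : Equiv.Perm ℕ)⁻¹ : Equiv.Perm ℕ) then 1 else 0)) := by
      intro g hg h hh
      have hfix : ∀ n, N ≤ n → ((g⁻¹ * h : SInf) : Equiv.Perm ℕ) n = n := by
        intro n hn
        simp only [Subgroup.coe_mul, Subgroup.coe_inv, Equiv.Perm.mul_apply]
        rw [hN h hh n hn, Equiv.Perm.inv_eq_iff_eq, hN g hg n hn]
      rw [W.chi_eq_sum _ hfix, Complex.ofReal_sum, Finset.mul_sum]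
      refine Finset.sum_congr rfl fun f _ => ?_
      have := extend_inv (g : Equiv.Perm ℕ) h f
      simp only [Subgroup.coe_mul, Subgroup.coe_inv, this]
      split_ifs <;> push_cast <;> ring
    rw [Finset.sum_congr rfl fun g hg => Finset.sum_congr rfl fun h hh => key g hg h hh]
    simp_rw [Finset.sum_comm (s := c.support) (t := (univ : Finset (Fin N → Fin d)))]
    rw [Complex.re_sum]
    refine Finset.sum_nonneg fun f _ => ?_
    simp_rw [← Finset.mul_sum]
    rw [Complex.re_ofReal_mul]
    exact mul_nonneg (Finset.prod_nonneg fun i _ => (W.pos _).le)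
      (sum_indicator_nonneg _ _ _)

end Weights

namespace PosTypeFun
variable {G : Type*} [Group G] (φ : PosTypeFun G)

set_option linter.unusedVariables false in
/-- The group algebra as a vector space, to be endowed with the semi-inner product given by `φ`. -/
def PreGNS (φ : PosTypeFun G) : Type _ := G →₀ ℂ

noncomputable instance : AddCommGroup φ.PreGNS := inferInstanceAs (AddCommGroup (G →₀ ℂ))
noncomputable instance : Module ℂ φ.PreGNS := inferInstanceAs (Module ℂ (G →₀ ℂ))

/-- The identity map onto the type synonym. -/
noncomputable def ofFinsupp : (G →₀ ℂ) ≃ₗ[ℂ] φ.PreGNS := LinearEquiv.refl ℂ _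

/-- The sesquilinear form with `⟪g, h⟫ = φ(g⁻¹ h)`, conjugate-linear in the first variable. -/
noncomputable def preInner (x y : G →₀ ℂ) : ℂ :=
  x.sum fun g a => y.sum fun h b => conj a * b * φ.toFun (g⁻¹ * h)

/-- That form is a semi-inner product. -/
noncomputable abbrev preGNSCore : PreInnerProductSpace.Core ℂ φ.PreGNS where
  inner x y := φ.preInner (φ.ofFinsupp.symm x) (φ.ofFinsupp.symm y)
  conj_inner_symm x y := by
    simp only [preInner, Finsupp.sum, map_sum, map_mul, Complex.conj_conj]
    rw [Finset.sum_comm]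
    refine Finset.sum_congr rfl fun g _ => Finset.sum_congr rfl fun h _ => ?_
    rw [← φ.conj_inv (g⁻¹ * h), mul_inv_rev, inv_inv]
    ring
  re_inner_nonneg x := φ.nonneg _
  add_left x y z := by
    rw [map_add]
    unfold preInner
    refine Finsupp.sum_add_index' (fun g => by simp) fun g a b => ?_
    rw [← Finsupp.sum_add]
    simp only [map_add, add_mul]
  smul_left x y r := by
    rw [map_smul]
    unfold preInner
    rw [Finsupp.sum_smul_index (fun g => by simp), Finsupp.mul_sum]
    simp only [Finsupp.mul_sum, map_mul, mul_assoc]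

noncomputable instance : SeminormedAddCommGroup φ.PreGNS :=
  InnerProductSpace.Core.toSeminormedAddCommGroup (c := φ.preGNSCore)
noncomputable instance : InnerProductSpace ℂ φ.PreGNS :=
  InnerProductSpace.ofCore φ.preGNSCore

theorem preInner_single (g h : G) (a b : ℂ) :
    φ.preInner (Finsupp.single g a) (Finsupp.single h b) = conj a * b * φ.toFun (g⁻¹ * h) := by
  simp [preInner]

theorem inner_preGNS (x y : G →₀ ℂ) : ⟪φ.ofFinsupp x, φ.ofFinsupp y⟫_ℂ = φ.preInner x y := rfl

theorem preInner_mapDomain (σ : G) (x y : G →₀ ℂ) :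
    φ.preInner (x.mapDomain (σ * ·)) (y.mapDomain (σ * ·)) = φ.preInner x y := by
  unfold preInner
  rw [Finsupp.sum_mapDomain_index_inj (mul_right_injective σ)]
  simp_rw [Finsupp.sum_mapDomain_index_inj (mul_right_injective σ)]
  simp [mul_assoc]

/-- Left translation by `σ`, before completion. -/
noncomputable def preRep (σ : G) : φ.PreGNS →ₗᵢ[ℂ] φ.PreGNS :=
  ((φ.ofFinsupp.symm.trans (Finsupp.domLCongr (Equiv.mulLeft σ))).trans
    φ.ofFinsupp).toLinearMap.isometryOfInner fun x y => by
      have := φ.preInner_mapDomain σ (φ.ofFinsupp.symm x) (φ.ofFinsupp.symm y)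
      rw [← inner_preGNS, ← inner_preGNS] at this
      simpa [Finsupp.equivMapDomain_eq_mapDomain] using this

/-- The GNS Hilbert space of `φ`: the separated completion of the group algebra. -/
abbrev GNS : Type _ := UniformSpace.Completion φ.PreGNS

/-- The vector `σ̂` of the GNS space. -/
noncomputable def hat (σ : G) : φ.GNS := (φ.ofFinsupp (Finsupp.single σ 1) : φ.PreGNS)

/-- The GNS representation, `U(σ) τ̂ = (σ τ)^` (see `rep_hat`). -/
noncomputable def rep (σ : G) : φ.GNS →L[ℂ] φ.GNS :=
  (φ.preRep σ).toContinuousLinearMap.completion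

theorem inner_hat (σ τ : G) : ⟪φ.hat σ, φ.hat τ⟫_ℂ = φ.toFun (σ⁻¹ * τ) := by
  rw [hat, hat, UniformSpace.Completion.inner_coe, inner_preGNS, preInner_single]
  simp

theorem rep_hat (σ τ : G) : φ.rep σ (φ.hat τ) = φ.hat (σ * τ) := by
  simp [rep, hat, preRep]

theorem dense_span_hat : Dense (Submodule.span ℂ (Set.range φ.hat) : Set φ.GNS) := by
  refine UniformSpace.Completion.denseRange_coe.mono ?_
  rintro _ ⟨x, rfl⟩
  obtain ⟨x, rfl⟩ := φ.ofFinsupp.surjective x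
  induction x using Finsupp.induction_linear with
  | zero =>
    rw [map_zero, UniformSpace.Completion.coe_zero]
    exact Submodule.zero_mem _
  | add x y hx hy =>
    rw [map_add, UniformSpace.Completion.coe_add]
    exact Submodule.add_mem _ hx hy
  | single g a =>
    have : Finsupp.single g a = a • Finsupp.single g (1 : ℂ) := by simp
    rw [this, map_smul, UniformSpace.Completion.coe_smul]
    exact Submodule.smul_mem _ _ (Submodule.subset_span ⟨g, rfl⟩)

end PosTypeFun
/-- `A` is the limit of the sequence `T` in the strong operator topology. -/
def IsSOTLimit {H : Type*} [NormedAddCommGroup H] [InnerProductSpace ℂ H]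
    (T : ℕ → H →L[ℂ] H) (A : H →L[ℂ] H) : Prop :=
  ∀ x, Tendsto (fun n => T n x) atTop (𝓝 (A x))

/-- `μ` is the law of the self-adjoint operator `T` with respect to the vector state of `ξ`:
it has bounded support and its `k`-th moment is `⟨T ^ k ξ, ξ⟩` for every `k`. -/
def IsLaw {H : Type*} [NormedAddCommGroup H] [InnerProductSpace ℂ H] [CompleteSpace H]
    (ξ : H) (T : H →L[ℂ] H) (μ : ProbabilityMeasure ℝ) : Prop :=
  IsSelfAdjoint T ∧ (∃ R : ℝ, ∀ᵐ t ∂(μ : Measure ℝ), |t| ≤ R) ∧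
    ∀ k : ℕ, ((∫ t, t ^ k ∂(μ : Measure ℝ) : ℝ) : ℂ) = ⟪ξ, (T ^ k) ξ⟫_ℂ

namespace Weights
variable {d : ℕ} (W : Weights d)

/-- The average of the first `n` represented star-transpositions. -/
noncomputable def starAverage (n : ℕ) : W.character.GNS →L[ℂ] W.character.GNS :=
  (n : ℂ)⁻¹ • ∑ i ∈ range n, W.character.rep (starGen i)

/-- The rescaled average `n^{-1/2} ∑_{i ≤ n} (U(γ_i) - A)`. -/
noncomputable def centredAverage (A : W.character.GNS →L[ℂ] W.character.GNS) (n : ℕ) :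
    W.character.GNS →L[ℂ] W.character.GNS :=
  ((Real.sqrt n : ℝ) : ℂ)⁻¹ • ∑ i ∈ range n, (W.character.rep (starGen i) - A)

end Weights

/-! The function χ enters only as a normalized central function of positive type; what drives the
proof is exchangeability. Conjugation by a permutation fixing the centre `0` permutes the
star-transpositions, and χ is central. Hence for fixed τ the unit vectors U(γ_i)τ̂ have one common
inner product for all pairs i ≠ j, so their averages are Cauchy. The averaged operators are
contractions, so they converge strongly to some A₀ (`exists_isSOTLimit_starAverage`).

The limit A₀ commutes with U of every permutation fixing `0`, so a mixed moment of the centred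
operators U(γ_i) - A₀ depends only on which indices coincide (`mixedMoment_map`). It vanishes if
some index occurs once, since averaging over that index replaces U(γ_i) by A₀
(`mixedMoment_eq_zero`).

Now tr(s_n^k) is n^{-k/2} times a sum of mixed moments over k-tuples, grouped by their kernel
partitions. Partitions with a singleton contribute nothing. The others have c ≤ k/2 blocks and
n(n-1)⋯(n-c+1) tuples each, so every moment converges, and only pair partitions survive in the limit
(`tendsto_normalized_sum`).

With h = ⌊k/2⌋, the same count bounds the k-th moments uniformly in n by 2^k h^k / h!
(`norm_normalized_sum_le`), whose exponential generating function is entire. The characteristic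
functions therefore converge to a function continuous at 0, and Lévy's theorem yields the limit law
(`exists_tendsto_of_tendsto_moments`). -/

/-! ### Characteristic functions and the method of moments -/

theorem charFun_hasSum_moments (μ : Measure ℝ) [IsProbabilityMeasure μ] {R : ℝ}
    (hR : ∀ᵐ x ∂μ, |x| ≤ R) (t : ℝ) :
    HasSum (fun k : ℕ => (t * Complex.I) ^ k / (k.factorial : ℂ) * ((∫ x, x ^ k ∂μ : ℝ) : ℂ))
      (charFun μ t) := by
  have key : HasSum (fun k : ℕ => ∫ x : ℝ, (t * Complex.I) ^ k / (k.factorial : ℂ) *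
      ((x ^ k : ℝ) : ℂ) ∂μ) (∫ x : ℝ, Complex.exp (t * x * Complex.I) ∂μ) := by
    refine hasSum_integral_of_dominated_convergence
      (fun (k : ℕ) (_ : ℝ) => (|t| * R) ^ k / (k.factorial : ℝ)) (fun k => ?_) (fun k => ?_) ?_ ?_ ?_
    · exact Continuous.aestronglyMeasurable (by fun_prop)
    · filter_upwards [hR] with x hx
      simp only [norm_mul, norm_div, norm_pow, Complex.norm_real, Complex.norm_I, mul_one,
        Real.norm_eq_abs, RCLike.norm_natCast]
      rw [mul_pow, mul_div_right_comm]
      gcongr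
    · exact ae_of_all _ fun _ => Real.summable_pow_div_factorial _
    · exact integrable_const _
    · refine ae_of_all _ fun x => ?_
      have := NormedSpace.expSeries_div_hasSum_exp (𝔸 := ℂ) (t * x * Complex.I)
      rw [← Complex.exp_eq_exp_ℂ] at this
      have e : ∀ k : ℕ, (t * Complex.I) ^ k / (k.factorial : ℂ) * ((x ^ k : ℝ) : ℂ) =
          (t * x * Complex.I) ^ k / (k.factorial : ℂ) := fun k => by
        push_cast
        ring
      simp_rw [e]
      exact this
  rw [charFun_apply_real]
  convert key using 2 with k
  rw [integral_const_mul, integral_complex_ofReal]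

/-- The filter is arbitrary because this is applied along an ultrafilter. -/
theorem ProbabilityMeasure.tendsto_charFun {ι : Type*} {l : Filter ι}
    {μ : ι → ProbabilityMeasure ℝ} {ν : ProbabilityMeasure ℝ} (h : Tendsto μ l (𝓝 ν)) (t : ℝ) :
    Tendsto (fun n => charFun (μ n : Measure ℝ) t) l (𝓝 (charFun (ν : Measure ℝ) t)) := by
  rw [ProbabilityMeasure.tendsto_iff_forall_integral_rclike_tendsto ℂ] at h
  simp_rw [charFun_eq_integral_innerProbChar]
  exact h _

/-- Lévy's theorem without a candidate for the limit. -/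
theorem exists_tendsto_of_tendsto_charFun {μ : ℕ → ProbabilityMeasure ℝ} {f : ℝ → ℂ}
    (hf : ContinuousAt f 0)
    (h : ∀ t, Tendsto (fun n => charFun (μ n : Measure ℝ) t) atTop (𝓝 (f t))) :
    ∃ ν, Tendsto μ atTop (𝓝 ν) := by
  -- Continuity of `f` at 0 gives tightness, and Prokhorov's theorem then supplies a cluster point
  -- ν, the missing candidate.
  have htight : IsTightMeasureSet {((ν : ProbabilityMeasure ℝ) : Measure ℝ) | ν ∈ Set.range μ} := by
    have := isTightMeasureSet_of_tendsto_charFun hf h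
    convert this using 1
    ext ν
    simp
  have hcomp := isCompact_closure_of_isTightMeasureSet htight
  obtain ⟨ν, -, hν⟩ := hcomp.exists_mapClusterPt (f := atTop) (u := μ)
    (Filter.le_principal_iff.2 (Filter.mem_map.2 (Filter.univ_mem' fun n =>
      subset_closure (Set.mem_range_self n))))
  obtain ⟨U, hU, hUν⟩ := mapClusterPt_iff_ultrafilter.1 hν
  refine ⟨ν, ProbabilityMeasure.tendsto_of_tendsto_charFun fun t => ?_⟩
  -- Along the ultrafilter the characteristic functions tend both to that of ν and to `f`, so the
  -- two agree.
  rw [tendsto_nhds_unique (ProbabilityMeasure.tendsto_charFun hUν t) ((h t).mono_left hU)]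
  exact h t

/-- The method of moments, for laws with moments dominated by those of an entire moment
generating function. -/
theorem exists_tendsto_of_tendsto_moments {μ : ℕ → ProbabilityMeasure ℝ}
    (hR : ∀ n, ∃ R : ℝ, ∀ᵐ x ∂(μ n : Measure ℝ), |x| ≤ R) {B : ℕ → ℝ}
    (hB : ∀ n k, |∫ x, x ^ k ∂(μ n : Measure ℝ)| ≤ B k)
    (hs : ∀ r : ℝ, 0 ≤ r → Summable fun k : ℕ => r ^ k / k.factorial * B k)
    {m : ℕ → ℝ} (hm : ∀ k, Tendsto (fun n => ∫ x, x ^ k ∂(μ n : Measure ℝ)) atTop (𝓝 (m k))) :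
    ∃ ν, Tendsto μ atTop (𝓝 ν) := by
  have hmB : ∀ k, |m k| ≤ B k := fun k =>
    le_of_tendsto ((hm k).abs) (Eventually.of_forall fun n => hB n k)
  have hterm : ∀ (t : ℝ) (k : ℕ) (y : ℝ), |y| ≤ B k →
      ‖(t * Complex.I) ^ k / (k.factorial : ℂ) * (y : ℂ)‖ ≤ |t| ^ k / k.factorial * B k := by
    intro t k y hy
    simp only [norm_mul, norm_div, norm_pow, Complex.norm_real, Complex.norm_I, mul_one,
      Real.norm_eq_abs, RCLike.norm_natCast]
    gcongr
  refine exists_tendsto_of_tendsto_charFun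
    (f := fun t : ℝ => ∑' k : ℕ, (t * Complex.I) ^ k / (k.factorial : ℂ) * (m k : ℂ)) ?_ ?_
  -- Continuity is needed only at 0, so the case `r = 1` of `hs` dominates the series uniformly on
  -- [-1, 1].
  · refine ContinuousOn.continuousAt (s := Set.Icc (-1) 1) ?_ (Icc_mem_nhds (by simp) (by simp))
    refine continuousOn_tsum (fun k => by fun_prop) (hs 1 zero_le_one) fun k t ht => ?_
    refine (hterm t k _ (hmB k)).trans ?_
    have : |t| ≤ 1 := abs_le.2 ht
    have hBk : 0 ≤ B k := (abs_nonneg _).trans (hmB k)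
    gcongr
  · intro t
    have : ∀ n, charFun (μ n : Measure ℝ) t = ∑' k : ℕ, (t * Complex.I) ^ k / (k.factorial : ℂ) *
        ((∫ x, x ^ k ∂(μ n : Measure ℝ) : ℝ) : ℂ) := fun n => by
      obtain ⟨R, h⟩ := hR n
      exact (charFun_hasSum_moments _ h t).tsum_eq.symm
    simp_rw [this]
    refine tendsto_tsum_of_dominated_convergence (hs |t| (abs_nonneg t)) (fun k => ?_)
      (Eventually.of_forall fun n k => hterm t k _ (hB n k))
    exact ((Complex.continuous_ofReal.tendsto _).comp (hm k)).const_mul _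

/-! ### Moment bounds and the combinatorics of index tuples -/

theorem summable_pow_half_div_factorial (a : ℝ) :
    Summable fun k : ℕ => a ^ k / (k / 2).factorial := by
  have h := Real.summable_pow_div_factorial (a ^ 2)
  refine Summable.even_add_odd ?_ ?_
  · refine h.congr fun k => ?_
    rw [pow_mul, Nat.mul_div_cancel_left _ two_pos]
  · refine (h.mul_left a).congr fun k => ?_
    have : (2 * k + 1) / 2 = k := by omega
    rw [this, pow_succ a (2 * k), pow_mul]
    ring

/-- With h = ⌊k/2⌋ one has h^k / k! ≤ e^h ≤ e^k, so the k-th term is at most (2er)^k / h!. -/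
theorem summable_moment_bound (r : ℝ) (hr : 0 ≤ r) : Summable fun k : ℕ =>
    r ^ k / (k.factorial : ℝ) * (2 ^ k * (((k / 2 : ℕ) : ℝ) ^ k / (k / 2).factorial)) := by
  refine Summable.of_nonneg_of_le (fun k => by positivity) (fun k => ?_)
    (summable_pow_half_div_factorial (r * 2 * Real.exp 1))
  have h1 : ((k / 2 : ℕ) : ℝ) ^ k / k.factorial ≤ Real.exp 1 ^ k := by
    refine (Real.pow_div_factorial_le_exp _ (by positivity) k).trans ?_
    rw [← Real.exp_nat_mul, mul_one]
    exact Real.exp_le_exp.2 (by exact_mod_cast Nat.div_le_self k 2)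
  calc _ = (r * 2) ^ k * (((k / 2 : ℕ) : ℝ) ^ k / k.factorial) / (k / 2).factorial := by
        rw [mul_pow]; ring
    _ ≤ (r * 2) ^ k * Real.exp 1 ^ k / (k / 2).factorial := by gcongr
    _ = _ := by rw [← mul_pow]

theorem tendsto_descFactorial_div_sqrt_pow {c k : ℕ} (h : 2 * c ≤ k) :
    ∃ l : ℝ, Tendsto (fun n : ℕ => (√n)⁻¹ ^ k * (n.descFactorial c : ℝ)) atTop (𝓝 l) := by
  have h1 : Tendsto (fun n : ℕ => (n.descFactorial c : ℝ) / (n : ℝ) ^ c) atTop (𝓝 1) := by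
    refine (Asymptotics.isEquivalent_iff_tendsto_one ?_).1 (isEquivalent_descFactorial c)
    filter_upwards [eventually_ge_atTop 1] with n hn
    have : (n : ℝ) ≠ 0 := by exact_mod_cast (by omega : n ≠ 0)
    positivity
  -- The limit `0 ^ (k - 2 * c)` covers both cases: it is 1 for k = 2c and 0 for k > 2c.
  have h2 : Tendsto (fun n : ℕ => (√n)⁻¹ ^ (k - 2 * c)) atTop (𝓝 (0 ^ (k - 2 * c))) :=
    (tendsto_inv_atTop_zero.comp
      (Real.tendsto_sqrt_atTop.comp tendsto_natCast_atTop_atTop)).pow _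
  refine ⟨_, (h2.mul h1).congr' ?_⟩
  filter_upwards [eventually_ge_atTop 1] with n hn
  have h3 : (n : ℝ) ≠ 0 := by exact_mod_cast (by omega : n ≠ 0)
  have h4 : √(n : ℝ) ≠ 0 := by positivity
  have h5 : (n : ℝ) ^ c = √n ^ (2 * c) := by rw [pow_mul, Real.sq_sqrt (Nat.cast_nonneg n)]
  obtain ⟨j, rfl⟩ := Nat.exists_eq_add_of_le h
  rw [h5, Nat.add_sub_cancel_left, pow_add, inv_pow _ (2 * c)]
  field_simp

theorem two_mul_card_image_le {k : ℕ} {α : Type*} [DecidableEq α] {i : Fin k → α}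
    (h : ∀ a, ∃ b ≠ a, i b = i a) : 2 * #(univ.image i) ≤ k := by
  have := Finset.mul_card_image_le_card (f := i) univ 2 (by
    intro b hb
    obtain ⟨a, -, rfl⟩ := Finset.mem_image.1 hb
    obtain ⟨b, hba, hb⟩ := h a
    rw [Nat.succ_le_iff, Finset.one_lt_card]
    exact ⟨b, by simp [hb], a, by simp, hba⟩)
  simpa using this

/-- The number of maps `Fin k → Fin n` without values taken exactly once is at most
`√n ^ k * (h ^ k / h!)` with `h = ⌊k / 2⌋`. -/
theorem card_no_singleton_le (k n : ℕ) (s : Finset (Fin k → Fin n))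
    (hs : ∀ i ∈ s, ∀ a, ∃ b ≠ a, i b = i a) :
    (√n)⁻¹ ^ k * (#s : ℝ) ≤ ((k / 2 : ℕ) : ℝ) ^ k / (k / 2).factorial := by
  classical
  set h := k / 2
  rcases Nat.eq_zero_or_pos k with rfl | hk
  · have : #s ≤ 1 := by simpa using Finset.card_le_univ s
    simpa [h] using this
  -- For n = 0 the factor `(√0)⁻¹` is 0, and k > 0 makes the left side vanish.
  rcases Nat.eq_zero_or_pos n with rfl | hn
  · have : k ≠ 0 := by omega
    simp only [Nat.cast_zero, Real.sqrt_zero, inv_zero, ne_eq, this, not_false_eq_true, zero_pow,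
      zero_mul]
    positivity
  have hn0 : (0 : ℝ) < n := by exact_mod_cast hn
  have hsq : 0 < √(n : ℝ) := by positivity
  rw [inv_pow, inv_mul_le_iff₀ (by positivity)]
  rcases le_or_gt h n with hhn | hhn
  -- Each such tuple has at most h values, hence takes its values in some h-element set S; there are
  -- C(n, h) choices of S and h^k maps into each.
  · have h1 : s ⊆ (powersetCard h univ).biUnion fun S => Fintype.piFinset fun _ : Fin k => S := by
      intro i hi
      have h2 := two_mul_card_image_le (hs i hi)
      obtain ⟨S, hS, hc⟩ := Finset.exists_superset_card_eq (s := univ.image i) (n := h) (by omega)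
        (by simpa using hhn)
      rw [Finset.mem_biUnion]
      refine ⟨S, by simp [hc], ?_⟩
      rw [Fintype.mem_piFinset]
      exact fun a => hS (by simp)
    have h2 : #s ≤ n.choose h * h ^ k := by
      refine (Finset.card_le_card h1).trans (Finset.card_biUnion_le.trans ?_)
      rw [Finset.sum_congr rfl (g := fun _ => h ^ k)]
      · simp
      · intro S hS
        rw [Fintype.card_piFinset]
        simp [(Finset.mem_powersetCard.1 hS).2]
    have h3 : (n : ℝ) ^ h ≤ √n ^ k := by
      have h4 : (n : ℝ) ^ h = √n ^ (2 * h) := by rw [pow_mul, Real.sq_sqrt hn0.le]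
      rw [h4]
      exact pow_le_pow_right₀ (Real.one_le_sqrt.2 (by exact_mod_cast hn)) (by omega)
    calc (#s : ℝ) ≤ (n.choose h : ℝ) * (h : ℝ) ^ k := by exact_mod_cast h2
      _ ≤ (n : ℝ) ^ h / h.factorial * (h : ℝ) ^ k := by
        gcongr
        exact Nat.choose_le_pow_div h n
      _ ≤ √n ^ k / h.factorial * (h : ℝ) ^ k := by gcongr
      _ = _ := by ring
  -- For n < h the trivial count n^k = √n^k √n^k suffices, because h! ≤ h^h ≤ √h^k.
  · have h1 : (#s : ℝ) ≤ (n : ℝ) ^ k := by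
      have := Finset.card_le_univ s
      simp only [Fintype.card_fun, Fintype.card_fin] at this
      exact_mod_cast this
    have h0 : (0 : ℝ) < h := by exact_mod_cast (by omega : 0 < h)
    have h2 : √(n : ℝ) ^ k * h.factorial ≤ (h : ℝ) ^ k := by
      have h3 : (h.factorial : ℝ) ≤ √(h : ℝ) ^ k := by
        calc (h.factorial : ℝ) ≤ (h : ℝ) ^ h := by exact_mod_cast h.factorial_le_pow
          _ = √(h : ℝ) ^ (2 * h) := by rw [pow_mul, Real.sq_sqrt h0.le]
          _ ≤ √(h : ℝ) ^ k := pow_le_pow_right₀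
            (Real.one_le_sqrt.2 (by exact_mod_cast (by omega : 1 ≤ h))) (by omega)
      have h4 : √(n : ℝ) ^ k ≤ √(h : ℝ) ^ k := by gcongr
      calc √(n : ℝ) ^ k * h.factorial ≤ √(h : ℝ) ^ k * √(h : ℝ) ^ k := by gcongr
        _ = (h : ℝ) ^ k := by rw [← mul_pow, Real.mul_self_sqrt h0.le]
    calc (#s : ℝ) ≤ (n : ℝ) ^ k := h1
      _ = √n ^ k * √n ^ k := by rw [← mul_pow, Real.mul_self_sqrt hn0.le]
      _ ≤ _ := by
        gcongr
        rw [le_div_iff₀ (by positivity)]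
        exact h2

theorem norm_normalized_sum_le {k : ℕ} {T : (Fin k → ℕ) → ℂ}
    (hs : ∀ i a, (∀ b ≠ a, i b ≠ i a) → T i = 0) {C : ℝ} (hC : ∀ i, ‖T i‖ ≤ C) (n : ℕ) :
    ‖((√n)⁻¹ ^ k : ℝ) * ∑ i : Fin k → Fin n, T (fun a => i a)‖ ≤
      C * (((k / 2 : ℕ) : ℝ) ^ k / (k / 2).factorial) := by
  classical
  have hC0 : 0 ≤ C := (norm_nonneg _).trans (hC fun _ => 0)
  have h1 : ∑ i : Fin k → Fin n, T (fun a => i a) =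
      ∑ i : Fin k → Fin n with ∀ a, ∃ b ≠ a, i b = i a, T (fun a => i a) := by
    rw [Finset.sum_filter_of_ne]
    intro i _ hi
    by_contra! h
    obtain ⟨a, ha⟩ := h
    exact hi (hs _ a fun b hb hab => ha b hb (Fin.ext hab))
  have h2 := card_no_singleton_le k n ({i | ∀ a, ∃ b ≠ a, i b = i a} : Finset (Fin k → Fin n))
    (fun i hi => by simpa using hi)
  rw [h1, norm_mul, Complex.norm_real, Real.norm_of_nonneg (by positivity)]
  calc _ ≤ (√n)⁻¹ ^ k * (#({i | ∀ a, ∃ b ≠ a, i b = i a} : Finset (Fin k → Fin n)) * C) := by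
        gcongr
        rw [← nsmul_eq_mul]
        exact (norm_sum_le _ _).trans (Finset.sum_le_card_nsmul _ _ _ fun i _ => hC _)
    _ = C * ((√n)⁻¹ ^ k * #({i | ∀ a, ∃ b ≠ a, i b = i a} : Finset (Fin k → Fin n))) := by ring
    _ ≤ _ := by gcongr

/-- The maps with a given kernel are the embeddings of the quotient. -/
def kerFiberEquiv {α β : Type*} (r : Setoid α) :
    {i : α → β // Setoid.ker i = r} ≃ (Quotient r ↪ β) where
  toFun i := ⟨Quotient.lift i.1 fun a b h => by rw [← i.2] at h; exact h, by
    rintro ⟨a⟩ ⟨b⟩ h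
    apply Quotient.sound
    have h' : Setoid.ker i.1 a b := h
    rw [i.2] at h'
    exact h'⟩
  invFun e := ⟨fun a => e (Quotient.mk r a), by
    ext a b
    rw [Setoid.ker_def, e.injective.eq_iff, Quotient.eq]⟩
  left_inv i := rfl
  right_inv e := by
    ext ⟨a⟩
    rfl

theorem Setoid.finite {α : Type*} [Finite α] : Finite (Setoid α) :=
  Finite.of_injective (fun r : Setoid α => (fun a b => r a b)) fun r s h =>
    Setoid.ext fun a b => by rw [show r a b = s a b from congrFun (congrFun h a) b]

/-- By `hex`, `T` is constant on the tuples with a given kernel r, and those are counted by a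
descending factorial. By `hs` only the r without singleton classes matter; they have at most k/2
classes, so each normalized count converges. -/
theorem tendsto_normalized_sum {k : ℕ} {T : (Fin k → ℕ) → ℂ}
    (hs : ∀ i a, (∀ b ≠ a, i b ≠ i a) → T i = 0)
    (hex : ∀ (m : ℕ) (p : Fin k → Fin m) (a b : Fin m → ℕ), a.Injective → b.Injective →
      T (a ∘ p) = T (b ∘ p)) :
    ∃ l : ℂ, Tendsto (fun n : ℕ => (((√n)⁻¹ ^ k : ℝ) : ℂ) * ∑ i : Fin k → Fin n, T (fun a => i a))
      atTop (𝓝 l) := by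
  classical
  have := Setoid.finite (α := Fin k)
  have := Fintype.ofFinite (Setoid (Fin k))
  let rep : (r : Setoid (Fin k)) → Fin k → ℕ := fun r a =>
    Fintype.equivFin (Quotient r) (Quotient.mk r a)
  have hsum : ∀ n : ℕ, ∑ i : Fin k → Fin n, T (fun a => i a) =
      ∑ r : Setoid (Fin k), (n.descFactorial (Fintype.card (Quotient r)) : ℂ) * T (rep r) := by
    intro n
    rw [← Finset.sum_fiberwise (g := fun i => Setoid.ker i)]
    refine Finset.sum_congr rfl fun r _ => ?_
    rw [Finset.sum_congr rfl (g := fun _ => T (rep r)), Finset.sum_const, nsmul_eq_mul]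
    · congr 2
      rw [← Fintype.card_subtype, Fintype.card_congr (kerFiberEquiv r), Fintype.card_embedding_eq,
        Fintype.card_fin]
    · intro i hi
      let e := kerFiberEquiv r ⟨i, (Finset.mem_filter.1 hi).2⟩
      let q := Fintype.equivFin (Quotient r)
      -- Both `i` and `rep r` factor through the numbering of the classes of r, followed by an
      -- injection into ℕ.
      have h1 := hex _ (fun a => q (Quotient.mk r a)) (fun x => e (q.symm x)) (fun x => x)
        (Fin.val_injective.comp (e.injective.comp q.symm.injective)) Fin.val_injective
      have h2 : (fun a => (i a : ℕ)) =
          (fun x => (e (q.symm x) : ℕ)) ∘ (fun a => q (Quotient.mk r a)) := by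
        funext a
        simp only [Function.comp_apply, Equiv.symm_apply_apply]
        rfl
      rw [h2, h1]
      rfl
  simp_rw [hsum, Finset.mul_sum]
  have hterm : ∀ r : Setoid (Fin k), ∃ l : ℂ, Tendsto (fun n : ℕ => (((√n)⁻¹ ^ k : ℝ) : ℂ) *
      ((n.descFactorial (Fintype.card (Quotient r)) : ℂ) * T (rep r))) atTop (𝓝 l) := by
    intro r
    by_cases h : ∀ a, ∃ b ≠ a, rep r b = rep r a
    · have hc : 2 * Fintype.card (Quotient r) ≤ k := by
        have h1 := two_mul_card_image_le (i := fun a => Quotient.mk r a) fun a => by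
          obtain ⟨b, hb, hab⟩ := h a
          exact ⟨b, hb, (Fintype.equivFin (Quotient r)).injective (Fin.ext hab)⟩
        rwa [Finset.image_univ_of_surjective Quotient.mk_surjective, Finset.card_univ] at h1
      obtain ⟨l, hl⟩ := tendsto_descFactorial_div_sqrt_pow hc
      refine ⟨(l : ℂ) * T (rep r), ?_⟩
      refine (((Complex.continuous_ofReal.tendsto l).comp hl).mul_const (T (rep r))).congr
        fun n => ?_
      simp only [Function.comp_apply]
      push_cast
      ring
    · push Not at h
      obtain ⟨a, ha⟩ := h
      exact ⟨0, by simp [hs _ a ha]⟩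
  choose l hl using hterm
  exact ⟨_, tendsto_finsetSum _ fun r _ => hl r⟩

/-! ### Laws of self-adjoint operators -/

section Law
variable {H : Type*} [NormedAddCommGroup H] [InnerProductSpace ℂ H] [CompleteSpace H]

/-- The functional `f ↦ ⟨f(T) ξ, ξ⟩` on the continuous functions on the spectrum of `T`. -/
noncomputable def spectralFunctional (ξ : H) {T : H →L[ℂ] H} (hT : IsSelfAdjoint T) :
    CompactlySupportedContinuousMap (spectrum ℝ T) ℝ →ₚ[ℝ] ℝ :=
  PositiveLinearMap.mk₀
    { toFun := fun f => (⟪ξ, cfcHom (R := ℝ) hT (f : C(spectrum ℝ T, ℝ)) ξ⟫_ℂ).re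
      map_add' := fun f g => by
        have : ((f + g : CompactlySupportedContinuousMap (spectrum ℝ T) ℝ) :
          C(spectrum ℝ T, ℝ)) = (f : C(spectrum ℝ T, ℝ)) + g := rfl
        rw [this, map_add, add_apply, inner_add_right, Complex.add_re]
      map_smul' := fun r f => by
        have : ((r • f : CompactlySupportedContinuousMap (spectrum ℝ T) ℝ) :
          C(spectrum ℝ T, ℝ)) = r • (f : C(spectrum ℝ T, ℝ)) := rfl
        rw [this, map_smul, smul_apply, inner_smul_right_eq_smul]
        simp }
    (fun f hf => by
      have h1 : 0 ≤ cfcHom (R := ℝ) hT (f : C(spectrum ℝ T, ℝ)) :=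
        (cfcHom_nonneg_iff hT).2 fun x => hf x
      exact ((ContinuousLinearMap.nonneg_iff_isPositive _).1 h1).re_inner_nonneg_right ξ)

/-- A self-adjoint operator has a law with respect to every unit vector. -/
theorem exists_isLaw (ξ : H) (hξ : ‖ξ‖ = 1) {T : H →L[ℂ] H} (hT : IsSelfAdjoint T) :
    ∃ μ, IsLaw ξ T μ := by
  let ν := RealRMK.rieszMeasure (spectralFunctional ξ hT)
  -- The spectrum is compact, so every continuous function on it has compact support and the Riesz
  -- representation covers the whole functional calculus.
  have hν : ∀ f : C(spectrum ℝ T, ℝ), ∫ x, f x ∂ν = (⟪ξ, cfcHom (R := ℝ) hT f ξ⟫_ℂ).re := fun f =>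
    RealRMK.integral_rieszMeasure (spectralFunctional ξ hT)
      (CompactlySupportedContinuousMap.continuousMapEquiv f)
  have hν1 : IsProbabilityMeasure ν := by
    have h := hν 1
    rw [map_one] at h
    simp only [ContinuousMap.one_apply, integral_const, smul_eq_mul, mul_one,
      one_apply_eq_self, inner_self_eq_norm_sq_to_K, hξ] at h
    refine ⟨?_⟩
    have h' : ν.real Set.univ = 1 := by simpa using h
    rw [Measure.real] at h'
    rw [← ENNReal.toReal_eq_one_iff]
    exact h'
  have hm : Measurable ((↑) : spectrum ℝ T → ℝ) := measurable_subtype_coe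
  let μ : ProbabilityMeasure ℝ :=
    ⟨ν.map ((↑) : spectrum ℝ T → ℝ), Measure.isProbabilityMeasure_map hm.aemeasurable⟩
  have hself : ∀ k, IsSelfAdjoint (T ^ k) := fun k => hT.pow k
  refine ⟨μ, hT, ?_, fun k => ?_⟩
  · obtain ⟨R, hR⟩ := (spectrum.isCompact (𝕜 := ℝ) T).isBounded.exists_norm_le
    refine ⟨R, ?_⟩
    change ∀ᵐ t ∂(ν.map _), _
    rw [ae_map_iff hm.aemeasurable (measurableSet_le (by fun_prop) measurable_const)]
    exact ae_of_all _ fun x => hR _ x.2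
  · have h1 : ∫ t, t ^ k ∂(μ : Measure ℝ) = (⟪ξ, (T ^ k) ξ⟫_ℂ).re := by
      change ∫ t, t ^ k ∂(ν.map _) = _
      rw [integral_map hm.aemeasurable (by fun_prop)]
      have := hν ((ContinuousMap.restrict (spectrum ℝ T) (ContinuousMap.id ℝ)) ^ k)
      rw [map_pow, cfcHom_id hT] at this
      exact this
    rw [h1]
    have h2 := hself k
    rw [ContinuousLinearMap.isSelfAdjoint_iff_isSymmetric] at h2
    exact Complex.conj_eq_iff_re.1 (by
      rw [inner_conj_symm]
      exact h2 ξ ξ)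
end Law

/-! ### Averages of exchangeable vectors and strong limits -/

section Average
variable {H : Type*} [NormedAddCommGroup H] [InnerProductSpace ℂ H]

theorem inner_sum_sum_of_exchangeable {v : ℕ → H} {c : ℂ} (h1 : ∀ i, ‖v i‖ = 1)
    (hc : ∀ i j, i ≠ j → ⟪v i, v j⟫_ℂ = c) (n m : ℕ) :
    ⟪∑ i ∈ range n, v i, ∑ j ∈ range m, v j⟫_ℂ =
      n * m * c + (min n m : ℕ) * (1 - c) := by
  have : ∀ i j, ⟪v i, v j⟫_ℂ = c + if i = j then 1 - c else 0 := fun i j => by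
    split_ifs with h
    · subst h
      rw [inner_self_eq_norm_sq_to_K, h1]
      simp
    · rw [hc i j h, add_zero]
  rw [sum_inner]
  simp_rw [inner_sum, this, Finset.sum_add_distrib, Finset.sum_ite_eq]
  simp only [Finset.sum_const, Finset.card_range, Finset.mem_range, ← Finset.sum_filter, nsmul_eq_mul]
  congr 1
  · ring
  · congr 1
    congr 1
    have : (range n).filter (· < m) = range (min n m) := by
      ext; simp
    rw [this, card_range]

/-- The averages satisfy ⟨a_n, a_m⟩ = c + (1 - c) / max(n, m), because only the min(n, m) diagonal
pairs contribute 1 instead of c. Hence ‖a_n - a_m‖² = (1/n - 1/m)(1 - c) for n ≤ m. -/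
theorem cauchySeq_average_of_exchangeable {v : ℕ → H} {c : ℂ} (h1 : ∀ i, ‖v i‖ = 1)
    (hc : ∀ i j, i ≠ j → ⟪v i, v j⟫_ℂ = c) :
    CauchySeq fun n : ℕ => (n : ℂ)⁻¹ • ∑ i ∈ range n, v i := by
  set a : ℕ → H := fun n : ℕ => (n : ℂ)⁻¹ • ∑ i ∈ range n, v i
  have hin : ∀ n m, 1 ≤ n → 1 ≤ m → ⟪a n, a m⟫_ℂ = c + ((max n m : ℕ) : ℂ)⁻¹ * (1 - c) := by
    intro n m hn hm
    have h0 : (n : ℂ) ≠ 0 := by exact_mod_cast (by omega : n ≠ 0)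
    have h0' : (m : ℂ) ≠ 0 := by exact_mod_cast (by omega : m ≠ 0)
    rw [inner_smul_left, inner_smul_right, inner_sum_sum_of_exchangeable h1 hc, map_inv₀,
      Complex.conj_natCast]
    rcases le_total n m with h | h
    · rw [min_eq_left h, max_eq_right h]
      field_simp
    · rw [min_eq_right h, max_eq_left h]
      field_simp
  have hd : ∀ n m, 1 ≤ n → n ≤ m → ‖a n - a m‖ ^ 2 ≤ (n : ℝ)⁻¹ * ‖1 - c‖ := by
    intro n m hn hm
    have hm1 := hn.trans hm
    have e : ((‖a n - a m‖ ^ 2 : ℝ) : ℂ) = (((n : ℝ)⁻¹ - (m : ℝ)⁻¹ : ℝ) : ℂ) * (1 - c) := by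
      have := inner_self_eq_norm_sq_to_K (𝕜 := ℂ) (a n - a m)
      rw [inner_sub_left, inner_sub_right, inner_sub_right, hin n n hn hn, hin n m hn hm1,
        hin m n hm1 hn, hin m m hm1 hm1, max_self, max_self, max_eq_right hm, max_eq_left hm]
        at this
      push_cast
      refine this.symm.trans ?_
      ring
    have h2 := congrArg norm e
    rw [norm_mul, Complex.norm_real, Complex.norm_real, Real.norm_of_nonneg (by positivity)] at h2
    rw [h2]
    have h3 : (m : ℝ)⁻¹ ≤ (n : ℝ)⁻¹ :=
      inv_anti₀ (by exact_mod_cast hn) (by exact_mod_cast hm)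
    have h4 : 0 ≤ (m : ℝ)⁻¹ := by positivity
    gcongr
    rw [Real.norm_of_nonneg (by linarith)]
    linarith
  rw [Metric.cauchySeq_iff']
  intro ε hε
  have hlim : Tendsto (fun n : ℕ => (n : ℝ)⁻¹ * ‖1 - c‖) atTop (𝓝 0) := by
    simpa using tendsto_inv_atTop_nhds_zero_nat.mul_const ‖1 - c‖
  obtain ⟨N, hN, hN1⟩ := ((hlim.eventually (gt_mem_nhds (by positivity : 0 < ε ^ 2))).and
    (eventually_ge_atTop 1)).exists
  refine ⟨N, fun n hn => ?_⟩
  rw [dist_comm, dist_eq_norm]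
  exact lt_of_pow_lt_pow_left₀ 2 hε.le ((hd N n hN1 hn).trans_lt hN)

/-- A uniformly bounded sequence of operators that is pointwise Cauchy on a set of dense span
converges strongly. -/
theorem exists_isSOTLimit [CompleteSpace H] {T : ℕ → H →L[ℂ] H} {C : ℝ} (hC : ∀ n, ‖T n‖ ≤ C)
    {s : Set H} (hs : Dense (Submodule.span ℂ s : Set H))
    (h : ∀ x ∈ s, CauchySeq fun n => T n x) : ∃ A, IsSOTLimit T A := by
  have hspan : ∀ x ∈ Submodule.span ℂ s, CauchySeq fun n => T n x := by
    intro x hx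
    induction hx using Submodule.span_induction with
    | mem x hx => exact h x hx
    | zero => simpa using cauchySeq_const 0
    | add x y _ _ hx hy =>
      simp only [map_add]
      exact hx.add hy
    | smul r x _ hx =>
      simp only [map_smul]
      exact (uniformContinuous_const_smul r).comp_cauchySeq hx
  have hall : ∀ x, CauchySeq fun n => T n x := by
    intro x
    have hC0 : 0 ≤ C := (norm_nonneg _).trans (hC 0)
    rw [Metric.cauchySeq_iff']
    intro ε hε
    -- The denominator has `C + 1` because `C` may be 0.
    obtain ⟨y, hy, hxy⟩ := Metric.dense_iff.1 hs x (ε / (3 * (C + 1))) (by positivity)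
    obtain ⟨N, hN⟩ := Metric.cauchySeq_iff'.1 (hspan y hxy) (ε / 3) (by positivity)
    refine ⟨N, fun n hn => ?_⟩
    have hb : ∀ n, dist (T n x) (T n y) ≤ ε / 3 := fun n => by
      rw [dist_eq_norm, ← map_sub]
      refine ((T n).le_of_opNorm_le (hC n) _).trans ?_
      rw [Metric.mem_ball, dist_comm, dist_eq_norm] at hy
      calc C * ‖x - y‖ ≤ (C + 1) * (ε / (3 * (C + 1))) := by gcongr; linarith
        _ = ε / 3 := by field_simp
    have h1 := dist_triangle4 (T n x) (T n y) (T N y) (T N x)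
    have h2 := hb N
    rw [dist_comm] at h2
    linarith [hb n, hN n hn]
  choose f hf using fun x => cauchySeq_tendsto_of_complete (hall x)
  exact ⟨continuousLinearMapOfTendsto T (tendsto_pi_nhds.2 hf), hf⟩

/-- Strong limits of uniformly bounded sequences can be multiplied. -/
theorem IsSOTLimit.mul {S T : ℕ → H →L[ℂ] H} {A B : H →L[ℂ] H} {C : ℝ} (hC : ∀ n, ‖S n‖ ≤ C)
    (hS : IsSOTLimit S A) (hT : IsSOTLimit T B) : IsSOTLimit (fun n => S n * T n) (A * B) := by
  intro x
  have h1 : Tendsto (fun n => S n (T n x - B x)) atTop (𝓝 0) := by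
    refine squeeze_zero_norm (fun n => (S n).le_of_opNorm_le (hC n) _) ?_
    have := ((hT x).sub_const (B x)).norm.const_mul C
    simpa using this
  simpa using h1.add (hS (B x))

theorem IsSOTLimit.opNorm_le {T : ℕ → H →L[ℂ] H} {A : H →L[ℂ] H} {C : ℝ} (h : IsSOTLimit T A)
    (hC : ∀ n, ‖T n‖ ≤ C) : ‖A‖ ≤ C :=
  A.opNorm_le_bound ((norm_nonneg _).trans (hC 0)) fun x =>
    le_of_tendsto (h x).norm (Eventually.of_forall fun n => (T n).le_of_opNorm_le (hC n) x)

theorem IsSOTLimit.isSelfAdjoint [CompleteSpace H] {T : ℕ → H →L[ℂ] H} {A : H →L[ℂ] H}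
    (h : IsSOTLimit T A) (hT : ∀ n, IsSelfAdjoint (T n)) : IsSelfAdjoint A := by
  rw [ContinuousLinearMap.isSelfAdjoint_iff_isSymmetric]
  intro x y
  refine tendsto_nhds_unique ((h x).inner (tendsto_const_nhds (x := y))) ?_
  refine ((tendsto_const_nhds (x := x)).inner (h y)).congr fun n => ?_
  exact (((ContinuousLinearMap.isSelfAdjoint_iff_isSymmetric).1 (hT n)) x y).symm

end Average

/-! ### Unitarity of the GNS representation and invariance of its vector state -/

namespace PosTypeFun
variable {G : Type*} [Group G] (φ : PosTypeFun G)

theorem ext_hat {S T : φ.GNS →L[ℂ] φ.GNS} (h : ∀ σ, S (φ.hat σ) = T (φ.hat σ)) : S = T :=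
  ContinuousLinearMap.ext_on φ.dense_span_hat (by rintro _ ⟨σ, rfl⟩; exact h σ)

theorem norm_rep_apply (σ : G) (x : φ.GNS) : ‖φ.rep σ x‖ = ‖x‖ := by
  induction x using UniformSpace.Completion.induction_on with
  | hp => exact isClosed_eq (by fun_prop) (by fun_prop)
  | ih x => simp [rep]

/-- The GNS representation as a homomorphism of monoids. -/
noncomputable def repHom : G →* (φ.GNS →L[ℂ] φ.GNS) where
  toFun := φ.rep
  map_one' := φ.ext_hat fun σ => by simp [rep_hat]
  map_mul' σ τ := φ.ext_hat fun ρ => by simp [rep_hat, mul_assoc]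

theorem rep_one : φ.rep 1 = 1 := φ.repHom.map_one

theorem rep_mul (σ τ : G) : φ.rep (σ * τ) = φ.rep σ * φ.rep τ := φ.repHom.map_mul σ τ

theorem rep_inv_mul_rep (σ : G) : φ.rep σ⁻¹ * φ.rep σ = 1 := by
  rw [← rep_mul, inv_mul_cancel, rep_one]

theorem rep_mul_rep_inv (σ : G) : φ.rep σ * φ.rep σ⁻¹ = 1 := by
  rw [← rep_mul, mul_inv_cancel, rep_one]

theorem norm_rep_le (σ : G) : ‖φ.rep σ‖ ≤ 1 :=
  ContinuousLinearMap.opNorm_le_bound _ zero_le_one fun x => by rw [norm_rep_apply, one_mul]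

theorem inner_rep_rep (σ : G) (x y : φ.GNS) : ⟪φ.rep σ x, φ.rep σ y⟫_ℂ = ⟪x, y⟫_ℂ :=
  LinearIsometry.inner_map_map ⟨(φ.rep σ).toLinearMap, φ.norm_rep_apply σ⟩ x y

theorem inner_rep_left (σ : G) (x y : φ.GNS) : ⟪φ.rep σ x, y⟫_ℂ = ⟪x, φ.rep σ⁻¹ y⟫_ℂ := by
  rw [← φ.inner_rep_rep σ x, ← mul_apply_eq_comp, rep_mul_rep_inv, one_apply_eq_self]

theorem isSelfAdjoint_rep {σ : G} (h : σ⁻¹ = σ) : IsSelfAdjoint (φ.rep σ) := by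
  rw [ContinuousLinearMap.isSelfAdjoint_iff_isSymmetric]
  intro x y
  have := φ.inner_rep_left σ x y
  rwa [h] at this

/-- If `φ` is central, then the vector state of the unit is invariant under conjugation on the
algebra generated by the representation. -/
theorem inner_conj_of_mem_adjoin (hφ : ∀ σ τ, φ.toFun (τ * σ * τ⁻¹) = φ.toFun σ)
    {X : φ.GNS →L[ℂ] φ.GNS} (hX : X ∈ Algebra.adjoin ℂ (Set.range φ.rep)) (τ : G) :
    ⟪φ.hat 1, (φ.rep τ * X * φ.rep τ⁻¹) (φ.hat 1)⟫_ℂ = ⟪φ.hat 1, X (φ.hat 1)⟫_ℂ := by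
  -- The operators U(σ) already form a monoid, so the algebra is their linear span, and on a single
  -- U(σ) the invariance is centrality of `φ`.
  have h1 : Set.range φ.rep = (MonoidHom.mrange φ.repHom : Set (φ.GNS →L[ℂ] φ.GNS)) := rfl
  rw [h1, ← Subalgebra.mem_toSubmodule, Algebra.adjoin_eq_span, Submonoid.closure_eq] at hX
  induction hX using Submodule.span_induction with
  | mem X hX =>
    obtain ⟨σ, rfl⟩ := hX
    change ⟪φ.hat 1, (φ.rep τ * φ.rep σ * φ.rep τ⁻¹) (φ.hat 1)⟫_ℂ =
      ⟪φ.hat 1, φ.rep σ (φ.hat 1)⟫_ℂ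
    rw [← rep_mul, ← rep_mul, rep_hat, rep_hat, inner_hat, inner_hat]
    simpa using hφ σ τ
  | zero => simp
  | add X Y _ _ hX hY => simp only [mul_add, add_mul, add_apply, inner_add_right, hX, hY]
  | smul r X _ hX =>
    simp only [mul_smul_comm, smul_mul_assoc, smul_apply, inner_smul_right, hX]

/-- That invariance persists in strong limits. -/
theorem inner_conj_of_isSOTLimit (hφ : ∀ σ τ, φ.toFun (τ * σ * τ⁻¹) = φ.toFun σ)
    {X : ℕ → φ.GNS →L[ℂ] φ.GNS} {Y : φ.GNS →L[ℂ] φ.GNS}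
    (hX : ∀ n, X n ∈ Algebra.adjoin ℂ (Set.range φ.rep)) (h : IsSOTLimit X Y) (τ : G) :
    ⟪φ.hat 1, (φ.rep τ * Y * φ.rep τ⁻¹) (φ.hat 1)⟫_ℂ = ⟪φ.hat 1, Y (φ.hat 1)⟫_ℂ := by
  refine tendsto_nhds_unique (f := fun n => ⟪φ.hat 1, X n (φ.hat 1)⟫_ℂ) (l := atTop) ?_
    (tendsto_const_nhds.inner (h _))
  simp_rw [← φ.inner_conj_of_mem_adjoin hφ (hX _) τ]
  exact tendsto_const_nhds.inner (((φ.rep τ).continuous.tendsto _).comp (h _))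

end PosTypeFun

/-! ### Permutations acting on the star-transpositions -/

theorem starGen_inv (m : ℕ) : (starGen m)⁻¹ = starGen m :=
  Subtype.ext (Equiv.swap_inv 0 (m + 1))

/-- The permutation that fixes `0` and acts as `g` on the indices of the star-transpositions. -/
def starShift (g : SInf) : SInf :=
  ⟨{ toFun := fun n => Nat.casesOn n 0 fun m => (g : Equiv.Perm ℕ) m + 1
     invFun := fun n => Nat.casesOn n 0 fun m => (g : Equiv.Perm ℕ)⁻¹ m + 1
     left_inv := by rintro (_ | m) <;> simp
     right_inv := by rintro (_ | m) <;> simp }, by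
    obtain ⟨N, hN⟩ := g.2
    refine ⟨N + 1, ?_⟩
    rintro (_ | n) hn
    · omega
    · exact congrArg (· + 1) (hN n (by omega))⟩

theorem starShift_conj_starGen (g : SInf) (m : ℕ) :
    starShift g * starGen m * (starShift g)⁻¹ = starGen ((g : Equiv.Perm ℕ) m) :=
  Subtype.ext (Equiv.swap_apply_apply (starShift g : Equiv.Perm ℕ) 0 (m + 1)).symm

/-- Both tuples lie in some {0, …, N - 1}, whose symmetric group is m-transitive; the permutation
found there is extended by the identity. -/
theorem exists_SInf_comp_eq {m : ℕ} {a b : Fin m → ℕ} (ha : a.Injective) (hb : b.Injective) :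
    ∃ g : SInf, ∀ x, (g : Equiv.Perm ℕ) (a x) = b x := by
  let N := univ.sup a + univ.sup b + 1
  have haN : ∀ x, a x < N := fun x => by
    have := Finset.le_sup (f := a) (Finset.mem_univ x)
    omega
  have hbN : ∀ x, b x < N := fun x => by
    have := Finset.le_sup (f := b) (Finset.mem_univ x)
    omega
  obtain ⟨p, hp⟩ := (Equiv.Perm.isMultiplyPretransitive (Fin N) m).exists_smul_eq
    (⟨fun x => ⟨a x, haN x⟩, fun x y h => ha (by simpa using h)⟩ : Fin m ↪ Fin N)
    ⟨fun x => ⟨b x, hbN x⟩, fun x y h => hb (by simpa using h)⟩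
  refine ⟨⟨p.extendDomain Fin.equivSubtype, N, fun n hn =>
    p.extendDomain_apply_not_subtype _ (by omega)⟩, fun x => ?_⟩
  have h1 := p.extendDomain_apply_image Fin.equivSubtype ⟨a x, haN x⟩
  have h2 : p ⟨a x, haN x⟩ = ⟨b x, hbN x⟩ := DFunLike.congr_fun hp x
  rw [h2] at h1
  exact h1

/-! ### The strong limit of the averages -/

namespace Weights
variable {d : ℕ} (W : Weights d)

theorem chi_one : W.chi 1 = 1 := by
  rw [W.chi_eq_sum (N := 0) 1 fun n _ => rfl]
  simp

/-- The map V ↦ τ(V) carries the orbits of σ to those of τστ⁻¹ and preserves their sizes. -/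
theorem chi_conj (σ τ : SInf) : W.chi (τ * σ * τ⁻¹) = W.chi σ := by
  let e : Set ℕ ≃ Set ℕ := Equiv.Set.congr (τ : Equiv.Perm ℕ)
  unfold chi
  rw [← finprod_comp_equiv e]
  refine finprod_congr fun V => ?_
  have hV : (e V).ncard = V.ncard := Set.ncard_image_of_injective _ (τ : Equiv.Perm ℕ).injective
  have he : e V = (τ : Equiv.Perm ℕ) '' V := rfl
  have h : e V ∈ permOrbits ((τ * σ * τ⁻¹ : SInf) : Equiv.Perm ℕ) ↔
      V ∈ permOrbits (σ : Equiv.Perm ℕ) := by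
    have h1 : ∀ a, {b | ((τ * σ * τ⁻¹ : SInf) : Equiv.Perm ℕ).SameCycle ((τ : Equiv.Perm ℕ) a) b} =
        e {b | (σ : Equiv.Perm ℕ).SameCycle a b} := fun a => by
      ext b
      change _ ↔ b ∈ (τ : Equiv.Perm ℕ) '' _
      rw [Equiv.image_eq_preimage_symm]
      simp [Equiv.Perm.sameCycle_conj]
    constructor
    · rintro ⟨a, ha⟩
      obtain ⟨a, rfl⟩ := (τ : Equiv.Perm ℕ).surjective a
      exact ⟨a, e.injective ((h1 a).symm.trans ha)⟩
    · rintro ⟨a, rfl⟩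
      exact ⟨(τ : Equiv.Perm ℕ) a, h1 a⟩
  rw [hV]
  exact finprod_congr_Prop (by rw [h]) fun _ => rfl

theorem character_conj (σ τ : SInf) :
    W.character.toFun (τ * σ * τ⁻¹) = W.character.toFun σ :=
  congrArg Complex.ofReal (W.chi_conj σ τ)

theorem norm_hat (σ : SInf) : ‖W.character.hat σ‖ = 1 := by
  have h : ⟪W.character.hat σ, W.character.hat σ⟫_ℂ = 1 := by
    rw [PosTypeFun.inner_hat, inv_mul_cancel]
    exact (congrArg Complex.ofReal W.chi_one).trans Complex.ofReal_one
  have h' : ‖W.character.hat σ‖ ^ 2 = 1 := by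
    rw [← inner_self_eq_norm_sq (𝕜 := ℂ), h]
    simp
  exact (pow_eq_one_iff_of_nonneg (norm_nonneg _) two_ne_zero).1 h'

theorem norm_starAverage_le (n : ℕ) : ‖W.starAverage n‖ ≤ 1 := by
  unfold starAverage
  rw [norm_smul, norm_inv, RCLike.norm_natCast]
  refine (mul_le_mul_of_nonneg_left (norm_sum_le_of_le _ fun i _ =>
    W.character.norm_rep_le (starGen i)) (by positivity)).trans ?_
  rw [Finset.sum_const, Finset.card_range, nsmul_eq_mul, mul_one]
  exact inv_mul_le_one

/-- For i ≠ j the inner product of U(γ_i)τ̂ and U(γ_j)τ̂ is χ(τ⁻¹γ_iγ_jτ) = χ(γ_iγ_j). Conjugating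
by a permutation that fixes the centre and moves the index pair (0, 1) to (i, j) shows that it does
not depend on the pair. -/
theorem exists_isSOTLimit_starAverage : ∃ A₀, IsSOTLimit W.starAverage A₀ := by
  refine exists_isSOTLimit W.norm_starAverage_le W.character.dense_span_hat ?_
  rintro _ ⟨τ, rfl⟩
  have := cauchySeq_average_of_exchangeable (v := fun i => W.character.rep (starGen i)
    (W.character.hat τ)) (c := W.character.toFun ((starGen 0)⁻¹ * starGen 1))
    (fun i => by rw [PosTypeFun.norm_rep_apply, norm_hat]) (fun i j hij => by
      obtain ⟨g, hg⟩ := exists_SInf_comp_eq (a := ![0, 1]) (b := ![i, j])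
        (by simp [Function.Injective, Fin.forall_fin_two])
        (by simp [Function.Injective, Fin.forall_fin_two, hij, hij.symm])
      have h0 : (g : Equiv.Perm ℕ) 0 = i := hg 0
      have h1 : (g : Equiv.Perm ℕ) 1 = j := hg 1
      rw [PosTypeFun.rep_hat, PosTypeFun.rep_hat, PosTypeFun.inner_hat,
        ← W.character_conj _ τ, ← W.character_conj ((starGen 0)⁻¹ * starGen 1) (starShift g),
        ← h0, ← h1, ← starShift_conj_starGen, ← starShift_conj_starGen]
      congr 1
      group)
  simpa [starAverage] using this

end Weights

/-! ### Mixed moments of the centred star-transpositions -/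

theorem sum_pow_eq_sum_prod_ofFn {R : Type*} [Semiring R] {n : ℕ} (x : ℕ → R) (k : ℕ) :
    (∑ i ∈ range n, x i) ^ k =
      ∑ i : Fin k → Fin n, ((List.ofFn fun a => (i a : ℕ)).map x).prod := by
  induction k with
  | zero => simp
  | succ k ih =>
    rw [pow_succ', ih, ← Fin.sum_univ_eq_sum_range, Finset.sum_mul_sum,
      ← (Fin.consEquiv fun _ => Fin n).sum_comp, Fintype.sum_prod_type]
    simp [Fin.consEquiv, List.ofFn_succ]

namespace Weights
variable {d : ℕ} (W : Weights d)

/-- The product of the centred star-transpositions `U(γ_m) - B` along a list of indices. -/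
noncomputable def centredWord (B : W.character.GNS →L[ℂ] W.character.GNS) (l : List ℕ) :
    W.character.GNS →L[ℂ] W.character.GNS :=
  (l.map fun m => W.character.rep (starGen m) - B).prod

variable {A₀ : W.character.GNS →L[ℂ] W.character.GNS}

theorem norm_centredWord_le {B : W.character.GNS →L[ℂ] W.character.GNS} (hB : ‖B‖ ≤ 1)
    (l : List ℕ) : ‖W.centredWord B l‖ ≤ 2 ^ l.length := by
  induction l with
  | nil => exact ContinuousLinearMap.norm_id_le
  | cons m l ih =>
    rw [centredWord, List.map_cons, List.prod_cons, List.length_cons, pow_succ']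
    refine (norm_mul_le _ _).trans (mul_le_mul ?_ ih (norm_nonneg _) zero_le_two)
    exact (norm_sub_le_of_le (W.character.norm_rep_le _) hB).trans_eq one_add_one_eq_two

theorem starAverage_mem_adjoin (n : ℕ) :
    W.starAverage n ∈ Algebra.adjoin ℂ (Set.range W.character.rep) :=
  Subalgebra.smul_mem _ (Subalgebra.sum_mem _ fun _ _ =>
    Algebra.subset_adjoin (Set.mem_range_self _)) _

theorem centredWord_starAverage_mem_adjoin (n : ℕ) (l : List ℕ) :
    W.centredWord (W.starAverage n) l ∈ Algebra.adjoin ℂ (Set.range W.character.rep) := by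
  refine Subalgebra.list_prod_mem _ fun X hX => ?_
  obtain ⟨m, -, rfl⟩ := List.mem_map.1 hX
  exact Subalgebra.sub_mem _ (Algebra.subset_adjoin (Set.mem_range_self _))
    (W.starAverage_mem_adjoin n)

/-- Words in the averages lie in the algebra generated by the representation, where the vector state
is conjugation invariant; this limit carries the invariance over to words in A₀. -/
theorem isSOTLimit_centredWord (h : IsSOTLimit W.starAverage A₀) (l : List ℕ) :
    IsSOTLimit (fun n => W.centredWord (W.starAverage n) l) (W.centredWord A₀ l) := by
  induction l with
  | nil => exact fun x => tendsto_const_nhds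
  | cons m l ih =>
    refine IsSOTLimit.mul (S := fun n => W.character.rep (starGen m) - W.starAverage n) (C := 2)
      (fun n => ?_) (fun x => (tendsto_const_nhds (x := W.character.rep (starGen m) x)).sub (h x))
      ih
    exact (norm_sub_le_of_le (W.character.norm_rep_le _) (W.norm_starAverage_le n)).trans_eq
      one_add_one_eq_two

theorem rep_conj_starGen (g : SInf) (m : ℕ) :
    W.character.rep (starShift g) * W.character.rep (starGen m) *
      W.character.rep (starShift g)⁻¹ = W.character.rep (starGen ((g : Equiv.Perm ℕ) m)) := by
  rw [← PosTypeFun.rep_mul, ← PosTypeFun.rep_mul, starShift_conj_starGen]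

/-- Since g moves only finitely many indices, it permutes {0, …, n - 1} for all large n, so
conjugation already fixes the n-th average. -/
theorem rep_conj_limit (h : IsSOTLimit W.starAverage A₀) (g : SInf) :
    W.character.rep (starShift g) * A₀ * W.character.rep (starShift g)⁻¹ = A₀ := by
  obtain ⟨N, hN⟩ := g.2
  ext1 x
  refine tendsto_nhds_unique (((W.character.rep (starShift g)).continuous.tendsto _).comp
    (h (W.character.rep (starShift g)⁻¹ x))) ((h x).congr' ?_)
  filter_upwards [eventually_ge_atTop N] with n hn
  have : W.starAverage n = W.character.rep (starShift g) * W.starAverage n *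
      W.character.rep (starShift g)⁻¹ := by
    unfold starAverage
    rw [mul_smul_comm, smul_mul_assoc, Finset.mul_sum, Finset.sum_mul]
    simp_rw [rep_conj_starGen]
    rw [Equiv.Perm.sum_comp (g : Equiv.Perm ℕ) (range n)
      (fun i => W.character.rep (starGen i))]
    intro m hm
    by_contra hmn
    exact hm (hN m (by simp at hmn; omega))
  conv_lhs => rw [this]
  rfl

theorem rep_conj_centredWord (h : IsSOTLimit W.starAverage A₀) (g : SInf) (l : List ℕ) :
    W.character.rep (starShift g) * W.centredWord A₀ l * W.character.rep (starShift g)⁻¹ =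
      W.centredWord A₀ (l.map (g : Equiv.Perm ℕ)) := by
  induction l with
  | nil => simp [centredWord, PosTypeFun.rep_mul_rep_inv]
  | cons m l ih =>
    simp only [centredWord, List.map_cons, List.prod_cons] at ih ⊢
    -- Writing A₀ as its own conjugate turns the first factor into a conjugate of U(γ_m) - A₀; the
    -- final rewrite undoes this elsewhere.
    rw [← ih, ← rep_conj_starGen, ← W.rep_conj_limit h g, ← sub_mul, ← mul_sub,
      W.rep_conj_limit h g]
    set V := W.character.rep (starShift g)
    set V' := W.character.rep (starShift g)⁻¹
    have hV : V' * V = 1 := W.character.rep_inv_mul_rep _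
    simp only [mul_assoc]
    rw [← mul_assoc V' V, hV, one_mul]

/-- The mixed moment `⟨(U(γ_{i₁}) - A₀) ⋯ (U(γ_{i_k}) - A₀) ê, ê⟩`. -/
noncomputable def mixedMoment (A₀ : W.character.GNS →L[ℂ] W.character.GNS) (l : List ℕ) : ℂ :=
  ⟪W.character.hat 1, W.centredWord A₀ l (W.character.hat 1)⟫_ℂ

/-- Exchangeability of the star-transpositions. -/
theorem mixedMoment_map (h : IsSOTLimit W.starAverage A₀) (g : SInf) (l : List ℕ) :
    W.mixedMoment A₀ (l.map (g : Equiv.Perm ℕ)) = W.mixedMoment A₀ l := by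
  unfold mixedMoment
  rw [← W.rep_conj_centredWord h]
  exact W.character.inner_conj_of_isSOTLimit W.character_conj
    (fun n => W.centredWord_starAverage_mem_adjoin n l) (W.isSOTLimit_centredWord h l) _

theorem norm_mixedMoment_le (h : IsSOTLimit W.starAverage A₀) (l : List ℕ) :
    ‖W.mixedMoment A₀ l‖ ≤ 2 ^ l.length := by
  refine (norm_inner_le_norm _ _).trans ?_
  rw [norm_hat, one_mul]
  refine (ContinuousLinearMap.le_of_opNorm_le _ (W.norm_centredWord_le
    (h.opNorm_le W.norm_starAverage_le) l) _).trans ?_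
  rw [norm_hat, mul_one]

/-- A mixed moment vanishes if some index occurs only once. -/
theorem mixedMoment_eq_zero (h : IsSOTLimit W.starAverage A₀) {l₁ l₂ : List ℕ} {c : ℕ}
    (h₁ : c ∉ l₁) (h₂ : c ∉ l₂) : W.mixedMoment A₀ (l₁ ++ c :: l₂) = 0 := by
  let F : (W.character.GNS →L[ℂ] W.character.GNS) → ℂ := fun X =>
    ⟪W.character.hat 1, W.centredWord A₀ l₁ (X (W.centredWord A₀ l₂ (W.character.hat 1)))⟫_ℂ
  have hF : ∀ m, W.mixedMoment A₀ (l₁ ++ m :: l₂) =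
      F (W.character.rep (starGen m)) - F A₀ := fun m => by
    simp [mixedMoment, F, centredWord, inner_sub_right, mul_apply_eq_comp]
  -- The transposition of c and m fixes all other letters, so the lone index c can be replaced by
  -- any unused m.
  have hM : ∀ m, m ∉ l₁ → m ∉ l₂ →
      W.mixedMoment A₀ (l₁ ++ m :: l₂) = W.mixedMoment A₀ (l₁ ++ c :: l₂) := by
    intro m hm₁ hm₂
    let g : SInf := ⟨Equiv.swap c m, c + m + 1, fun n hn =>
      Equiv.swap_apply_of_ne_of_ne (by omega) (by omega)⟩
    have hg : ∀ l : List ℕ, c ∉ l → m ∉ l → l.map (g : Equiv.Perm ℕ) = l := by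
      intro l hc hm
      conv_rhs => rw [← List.map_id l]
      refine List.map_congr_left fun x hx => ?_
      exact Equiv.swap_apply_of_ne_of_ne (fun e => hc (e ▸ hx)) (fun e => hm (e ▸ hx))
    rw [← W.mixedMoment_map h g (l₁ ++ c :: l₂), List.map_append, List.map_cons, hg _ h₁ hm₁,
      hg _ h₂ hm₂]
    simp [g]
  have hlim : Tendsto (fun m => F (W.character.rep (starGen m)) - F A₀) atTop
      (𝓝 (W.mixedMoment A₀ (l₁ ++ c :: l₂))) := by
    refine tendsto_const_nhds.congr' ?_
    filter_upwards [eventually_gt_atTop (l₁.sum + l₂.sum)] with m hm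
    rw [← hF]
    -- Each letter of a list of naturals is at most the sum of the list, so m is unused.
    refine (hM m ?_ ?_).symm
    · intro hml
      have := List.le_sum_of_mem hml
      omega
    · intro hml
      have := List.le_sum_of_mem hml
      omega
  -- The sequence is eventually equal to the moment, hence so is the limit of its Cesàro means; but
  -- these means are F(average) - F(A₀), which tend to 0 by strong convergence.
  have hlim2 := hlim.cesaro_smul
  have hlim3 : Tendsto (fun n => F (W.starAverage n) - F A₀) atTop (𝓝 0) := by
    have h1 : Tendsto (fun n => F (W.starAverage n)) atTop (𝓝 (F A₀)) :=
      tendsto_const_nhds.inner (((W.centredWord A₀ l₁).continuous.tendsto _).comp (h _))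
    simpa using h1.sub_const (F A₀)
  refine tendsto_nhds_unique hlim2 (hlim3.congr' ?_)
  filter_upwards [eventually_ge_atTop 1] with n hn
  have hn0 : (n : ℂ) ≠ 0 := by exact_mod_cast (by omega : n ≠ 0)
  have h2 : F (W.starAverage n) = (n : ℂ)⁻¹ * ∑ i ∈ range n, F (W.character.rep (starGen i)) := by
    simp only [F, starAverage, smul_apply, _root_.sum_apply, map_smul, map_sum, inner_smul_right,
      inner_sum]
  rw [h2, Finset.sum_sub_distrib, Finset.sum_const, Finset.card_range, nsmul_eq_mul,
    Complex.real_smul]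
  push_cast
  field_simp

theorem isSelfAdjoint_starAverage (n : ℕ) : IsSelfAdjoint (W.starAverage n) := by
  refine IsSelfAdjoint.smul (by simp [IsSelfAdjoint]) (isSelfAdjoint_sum _ fun i _ => ?_)
  exact W.character.isSelfAdjoint_rep (starGen_inv i)

theorem isSelfAdjoint_centredAverage (hA : IsSelfAdjoint A₀) (n : ℕ) :
    IsSelfAdjoint (W.centredAverage A₀ n) := by
  refine IsSelfAdjoint.smul (by simp [IsSelfAdjoint]) (isSelfAdjoint_sum _ fun i _ => ?_)
  exact (W.character.isSelfAdjoint_rep (starGen_inv i)).sub hA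

theorem inner_centredAverage_pow (A₀ : W.character.GNS →L[ℂ] W.character.GNS) (n k : ℕ) :
    ⟪W.character.hat 1, (W.centredAverage A₀ n ^ k) (W.character.hat 1)⟫_ℂ =
      (((√n)⁻¹ ^ k : ℝ) : ℂ) *
        ∑ i : Fin k → Fin n, W.mixedMoment A₀ (List.ofFn fun a => (i a : ℕ)) := by
  rw [centredAverage, smul_pow, sum_pow_eq_sum_prod_ofFn, smul_apply, inner_smul_right,
    _root_.sum_apply, inner_sum]
  push_cast
  rfl

theorem mixedMoment_ofFn_eq_zero (h : IsSOTLimit W.starAverage A₀) {k : ℕ} (i : Fin k → ℕ)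
    (a : Fin k) (ha : ∀ b ≠ a, i b ≠ i a) : W.mixedMoment A₀ (List.ofFn i) = 0 := by
  have hlen : (a : ℕ) < (List.ofFn i).length := by simp
  have hl : List.ofFn i = (List.ofFn i).take a ++ i a :: (List.ofFn i).drop (a + 1) := by
    conv_lhs => rw [← List.take_append_drop a (List.ofFn i), List.drop_eq_getElem_cons hlen]
    simp
  rw [hl]
  refine W.mixedMoment_eq_zero h ?_ ?_
  · intro hm
    obtain ⟨b, hb, he⟩ := List.mem_take_iff_getElem.1 hm
    have hb' : b < a ∧ b < k := by
      have : b < a := by simpa using hb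
      omega
    rw [List.getElem_ofFn] at he
    exact ha ⟨b, hb'.2⟩ (by simp [Fin.ext_iff]; omega) he
  · intro hm
    obtain ⟨b, hb, he⟩ := List.mem_drop_iff_getElem.1 hm
    have hb' : a + 1 + b < k := by
      have : b + (a + 1) < k := by simpa using hb
      omega
    rw [List.getElem_ofFn] at he
    exact ha ⟨a + 1 + b, hb'⟩ (by simp [Fin.ext_iff]; omega) he

theorem mixedMoment_ofFn_comp (h : IsSOTLimit W.starAverage A₀) {k m : ℕ} (p : Fin k → Fin m)
    {a b : Fin m → ℕ} (ha : a.Injective) (hb : b.Injective) :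
    W.mixedMoment A₀ (List.ofFn (a ∘ p)) = W.mixedMoment A₀ (List.ofFn (b ∘ p)) := by
  obtain ⟨g, hg⟩ := exists_SInf_comp_eq ha hb
  rw [← W.mixedMoment_map h g, List.map_ofFn]
  congr 2
  funext x
  exact hg _

end Weights

/-! ### The central limit theorem -/

theorem theorem2p5 (d : ℕ) (hd : 2 ≤ d) (W : Weights d) :
    ∃ A₀ : W.character.GNS →L[ℂ] W.character.GNS,
      IsSOTLimit W.starAverage A₀ ∧
      ∃ μ : ℕ → ProbabilityMeasure ℝ,
        (∀ n, IsLaw (W.character.hat 1) (W.centredAverage A₀ n) (μ n)) ∧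
        ∃ μw : ProbabilityMeasure ℝ, Tendsto μ atTop (𝓝 μw) := by
  obtain ⟨A₀, hA₀⟩ := W.exists_isSOTLimit_starAverage
  have hself := hA₀.isSelfAdjoint W.isSelfAdjoint_starAverage
  choose μ hμ using fun n => exists_isLaw (W.character.hat 1) (W.norm_hat 1)
    (W.isSelfAdjoint_centredAverage hself n)
  refine ⟨A₀, hA₀, μ, hμ, ?_⟩
  have hmom : ∀ n k, ((∫ t, t ^ k ∂(μ n : Measure ℝ) : ℝ) : ℂ) = (((√n)⁻¹ ^ k : ℝ) : ℂ) *
      ∑ i : Fin k → Fin n, W.mixedMoment A₀ (List.ofFn fun a => (i a : ℕ)) := fun n k => by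
    rw [(hμ n).2.2 k, W.inner_centredAverage_pow]
  have hlim : ∀ k : ℕ, ∃ m : ℝ,
      Tendsto (fun n => ∫ t, t ^ k ∂(μ n : Measure ℝ)) atTop (𝓝 m) := fun k => by
    obtain ⟨l, hl⟩ := tendsto_normalized_sum (T := fun i : Fin k → ℕ =>
      W.mixedMoment A₀ (List.ofFn i)) (W.mixedMoment_ofFn_eq_zero hA₀)
      (fun m p a b ha hb => W.mixedMoment_ofFn_comp hA₀ p ha hb)
    simp_rw [← hmom] at hl
    exact ⟨l.re, (Complex.continuous_re.tendsto l).comp hl⟩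
  choose m hm using hlim
  -- The bound `B k` is read off from `summable_moment_bound`; its factor 2^k comes from ‖U(γ_i) -
  -- A₀‖ ≤ 2.
  refine exists_tendsto_of_tendsto_moments (fun n => (hμ n).2.1) (fun n k => ?_)
    summable_moment_bound hm
  rw [← Real.norm_eq_abs, ← Complex.norm_real, hmom]
  exact norm_normalized_sum_le (T := fun i : Fin k → ℕ => W.mixedMoment A₀ (List.ofFn i))
    (W.mixedMoment_ofFn_eq_zero hA₀)
    (fun i => by simpa using W.norm_mixedMoment_le hA₀ (List.ofFn i)) n
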